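/- For an integer $n\ge 2$ let $$\sigma_n(u)=\frac{1}{(n-1)!}\sum_{j=0}^n(-1)^j\binom nj\Big(\frac n2+u-j\Big)_+^{n-1},\qquad u\in\mathbb R,$$ be the central B-spline of order $n$, where $(u)_+=\max\{u,0\}$, and for $w>0$ let $$(\mathcal D_w^{\sigma_n,\sigma_n}f)(x)=\sum_{k\in\mathbb Z}\sigma_n(wx-k)\,w\int_{\mathbb R}\sigma_n(wu-k)f(u)\,du,\qquad x\in\mathbb R.$$ For $1\le p<\infty$, $L^p(\mathbb R)$ is the usual space of real functions with its norm $\|\cdot\|_p$; for $p=\infty$ the symbol $L^p(\mathbb R)$ stands for the space of bounded uniformly continuous functions $\mathbb R\to\mathbb R$ with the supremum norm. For $r\ge1$ and $\delta>0$ put $$\omega_r(f,\delta)_p=\sup_{|t|\le\delta}\Big\|\sum_{j=0}^r\binom rj(-1)^{r-j}f(\cdot+jt)\Big\|_p .$$ Let $Lip(2,L^p)$ be the set of all $f\in L^p(\mathbb R)$ that are locally absolutely continuous (up to a modification on a null set) with $f'\in L^p(\mathbb R)$ and $\omega_1(f',\delta)_p=\mathcal O(\delta)$ as $\delta\to0^+$.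 Let $n\ge2$. There exists $C>0$, depending only on $n$, such that for every $1\le p\le\infty$ and every $f\in L^p(\mathbb R)$: for all $w>0$ the integrals and the series defining $\mathcal D_w^{\sigma_n,\sigma_n}f$ converge (at every $x$), $\mathcal D_w^{\sigma_n,\sigma_n}f\in L^p(\mathbb R)$, and $$\|\mathcal D_w^{\sigma_n,\sigma_n}f-f\|_p\le C\,\omega_2\Big(f,\frac1w\Big)_p .$$ In particular, if $f\in Lip(2,L^p)$, then $$\|\mathcal D_w^{\sigma_n,\sigma_n}f-f\|_p=\mathcal O(w^{-2}),\qquad w\to+\infty .$$ -/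

import Mathlib

open MeasureTheory Filter Topology
open scoped ENNReal NNReal

noncomputable section

namespace DurrmeyerSampling

/-- The central B-spline of order `n` (the formula is meant for `n ≥ 2`):
`σ_n(u) = 1/(n-1)! ∑_{j=0}^n (-1)^j (n choose j) (n/2 + u - j)_+^{n-1}`. -/
def centralBSpline (n : ℕ) (u : ℝ) : ℝ :=
  1 / ((n - 1).factorial : ℝ) *
    ∑ j ∈ Finset.range (n + 1),
      (-1 : ℝ) ^ j * (n.choose j : ℝ) * (max ((n : ℝ) / 2 + u - (j : ℝ)) 0) ^ (n - 1)

/-- The Durrmeyer sampling operator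
`(D_w^{φ,ψ} f)(x) = ∑_{k ∈ ℤ} φ(wx - k) w ∫ ψ(wu - k) f(u) du`. -/
def durrmeyer (φ ψ : ℝ → ℝ) (w : ℝ) (f : ℝ → ℝ) (x : ℝ) : ℝ :=
  ∑' k : ℤ, φ (w * x - k) * (w * ∫ u, ψ (w * u - k) * f u)

/-- All integrals in `D_w^{φ,ψ} f` exist, and its series converges (absolutely) at every point. -/
def DurrmeyerConverges (φ ψ : ℝ → ℝ) (w : ℝ) (f : ℝ → ℝ) : Prop :=
  (∀ k : ℤ, Integrable (fun u => ψ (w * u - k) * f u)) ∧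
  ∀ x : ℝ, Summable (fun k : ℤ => φ (w * x - k) * (w * ∫ u, ψ (w * u - k) * f u))

/-- The space `L^p(ℝ)`; for `p = ∞` it stands for the space `C(ℝ)` of all bounded, uniformly
continuous functions. -/
def InLp (p : ℝ≥0∞) (f : ℝ → ℝ) : Prop :=
  if p = ∞ then UniformContinuous f ∧ ∃ B : ℝ, ∀ x, |f x| ≤ B
  else MemLp f p volume

/-- The norm `‖f‖_p`; for `p = ∞` it is the supremum norm. -/
def normLp (p : ℝ≥0∞) (f : ℝ → ℝ) : ℝ≥0∞ :=
  if p = ∞ then ⨆ x : ℝ, ‖f x‖ₑ else eLpNorm f p volume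

/-- The finite difference `Δ_t^r(f, x) = ∑_{j=0}^r (r choose j) (-1)^{r-j} f(x + jt)`. -/
def finDiff (r : ℕ) (t : ℝ) (f : ℝ → ℝ) (x : ℝ) : ℝ :=
  ∑ j ∈ Finset.range (r + 1), (r.choose j : ℝ) * (-1 : ℝ) ^ (r - j) * f (x + j * t)

/-- The modulus of smoothness `ω_r(f, δ)_p = sup_{|t| ≤ δ} ‖Δ_t^r(f, ·)‖_p`. -/
def modulus (r : ℕ) (p : ℝ≥0∞) (f : ℝ → ℝ) (δ : ℝ) : ℝ≥0∞ :=
  ⨆ t : ℝ, ⨆ _ : |t| ≤ δ, normLp p (finDiff r t f)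

/-- `f` coincides almost everywhere with a locally absolutely continuous function, and `h` is its
almost everywhere (equivalently, distributional) derivative. -/
def IsLocACDeriv (f h : ℝ → ℝ) : Prop :=
  ∃ g : ℝ → ℝ, f =ᵐ[volume] g ∧ (∀ a b : ℝ, AbsolutelyContinuousOnInterval g a b) ∧
    ∀ᵐ x, HasDerivAt g (h x) x

/-- The Lipschitz space `Lip(β, L^p)`, `0 < β ≤ 1`: all `f ∈ L^p(ℝ)` with
`ω_1(f, δ)_p = O(δ^β)` as `δ → 0+`. -/
def InLipBase (β : ℝ) (p : ℝ≥0∞) (f : ℝ → ℝ) : Prop :=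
  InLp p f ∧ ∃ M : ℝ≥0, ∀ᶠ δ in 𝓝[>] (0 : ℝ), modulus 1 p f δ ≤ M * ENNReal.ofReal (δ ^ β)

/-- The space `W^r Lip(β, L^p)`: all `f ∈ L^p(ℝ)` such that `f, …, f^{(r-1)}` are locally
absolutely continuous and `f^{(r)} ∈ Lip(β, L^p)`; here `F i` is the derivative `f^{(i)}`. -/
def InWLip (r : ℕ) (β : ℝ) (p : ℝ≥0∞) (f : ℝ → ℝ) : Prop :=
  InLp p f ∧ ∃ F : ℕ → ℝ → ℝ, F 0 = f ∧ (∀ i < r, IsLocACDeriv (F i) (F (i + 1))) ∧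
    InLipBase β p (F r)

/-- The Lipschitz space `Lip(α, L^p) = W^r Lip(β, L^p)` for `α = r + β > 0`, where `r ≥ 0` is an
integer and `0 < β ≤ 1` (this determines `r` and `β`). -/
def InLip (α : ℝ) (p : ℝ≥0∞) (f : ℝ → ℝ) : Prop :=
  ∃ (r : ℕ) (β : ℝ), 0 < β ∧ β ≤ 1 ∧ α = r + β ∧ InWLip r β p f

end DurrmeyerSampling

end

open DurrmeyerSampling

/-!
The B-spline `σ_n` is obtained from the hat function `σ_2` by repeated averaging over intervals of
length one (`centralBSpline_succ`), so it is a continuous, even, nonnegative function with support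
in `[-n/2, n/2]` whose integer translates sum to `1` and reproduce the identity
(`isSplineKernel_centralBSpline`). Hence `D = D_w^{σ_n,σ_n}` is an integral operator whose kernel
is bounded by `w` and vanishes for `|x - u| > n/w`, and which reproduces affine functions
(`IsSplineKernel.durrmeyer_affine`).

For `h = 1/w` let `f_h` be the Steklov mean of `f` whose kernel is a hat function on `[-h, h]`.
In `D f - f = D (f - f_h) + (D f_h - f_h) + (f_h - f)` every term is dominated, at every point `x`,
by averages of the absolute values of second differences of `f` near `x`. For `f_h - f` this is the
symmetry of the hat function (`steklov_sub_eq`). For `D (f - f_h)` it then follows from the bound on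
the kernel. For `D f_h - f_h`, subtract from `f_h` its first-order Taylor polynomial at `x`, which
`D` reproduces; the remainder is controlled by `f_h''`, which is `h⁻²` times a second difference of
`f` (`IsSplineKernel.enorm_durrmeyer_steklov_sub_le`).

Minkowski's integral inequality (`lpSize_setLIntegral_le`) turns these pointwise bounds into bounds
by `ω_2(f, 1/w)_p`, with a constant independent of `p`. As the pointwise bounds hold everywhere, the
supremum norm is treated together with the norms for `p < ∞`.

If `f' ∈ L^p(ℝ)`, then a second difference of `f` is an integral of first differences of `f'`, so
`ω_2(f, δ)_p ≤ δ ω_1(f', δ)_p` (`IsLocACDeriv.modulus_two_le`), which gives the rate `w⁻²` on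
`Lip(2, L^p)`.
-/

noncomputable section

namespace DurrmeyerSampling

/-! ### Central B-splines as compactly supported kernels reproducing affine functions -/

/-- A continuous, nonnegative, even kernel vanishing outside `(-R, R)` whose integer translates
form a partition of unity and reproduce the identity. Both series have only finitely many nonzero
terms; they are encoded as sums over every symmetric range `-N ≤ k ≤ N` that contains them. -/
structure IsSplineKernel (σ : ℝ → ℝ) (R : ℝ) : Prop where
  continuous : Continuous σ
  nonneg : ∀ u, 0 ≤ σ u
  even : ∀ u, σ (-u) = σ u
  eq_zero : ∀ u, R ≤ |u| → σ u = 0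
  sum_eq_one : ∀ (u : ℝ) (N : ℕ), |u| + R ≤ N → ∑ k ∈ Finset.Icc (-N : ℤ) N, σ (u - k) = 1
  sum_mul_eq : ∀ (u : ℝ) (N : ℕ), |u| + R ≤ N →
    ∑ k ∈ Finset.Icc (-N : ℤ) N, (k : ℝ) * σ (u - k) = u

/-- The convolution of `σ` with the indicator function of `[-1/2, 1/2]`. -/
def boxAverage (σ : ℝ → ℝ) (u : ℝ) : ℝ := ∫ v in (u - 1 / 2)..(u + 1 / 2), σ v

lemma boxAverage_sub_int (σ : ℝ → ℝ) (u : ℝ) (k : ℤ) :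
    boxAverage σ (u - k) = ∫ v in (u - 1 / 2)..(u + 1 / 2), σ (v - k) := by
  rw [intervalIntegral.integral_comp_sub_right, boxAverage]
  congr 1 <;> ring

lemma abs_le_of_mem_uIcc_box {u v : ℝ} (hv : v ∈ Set.uIcc (u - 1 / 2) (u + 1 / 2)) :
    |v| ≤ |u| + 1 / 2 ∧ |u| - 1 / 2 ≤ |v| := by
  rw [Set.uIcc_of_le (by linarith)] at hv
  have h : |v - u| ≤ 1 / 2 := abs_le.2 ⟨by linarith [hv.1], by linarith [hv.2]⟩
  have h1 := abs_sub_abs_le_abs_sub v u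
  have h2 := abs_sub_abs_le_abs_sub u v
  rw [abs_sub_comm u v] at h2
  constructor <;> linarith

lemma IsSplineKernel.boxAverage {σ : ℝ → ℝ} {R : ℝ} (h : IsSplineKernel σ R) :
    IsSplineKernel (boxAverage σ) (R + 1 / 2) where
  continuous := by
    have hF : Continuous fun x => ∫ v in (0 : ℝ)..x, σ v :=
      intervalIntegral.continuous_primitive (fun a b => h.continuous.intervalIntegrable a b) 0
    have : DurrmeyerSampling.boxAverage σ = fun u =>
        (∫ v in (0 : ℝ)..(u + 1 / 2), σ v) - ∫ v in (0 : ℝ)..(u - 1 / 2), σ v := by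
      funext u
      exact (intervalIntegral.integral_interval_sub_left (h.continuous.intervalIntegrable _ _)
        (h.continuous.intervalIntegrable _ _)).symm
    rw [this]
    fun_prop
  nonneg u := intervalIntegral.integral_nonneg (by linarith) fun v _ => h.nonneg v
  even u := by
    have := intervalIntegral.integral_comp_neg (a := u - 1 / 2) (b := u + 1 / 2) σ
    simp only [h.even] at this
    rw [DurrmeyerSampling.boxAverage, DurrmeyerSampling.boxAverage, this]
    congr 1 <;> ring
  eq_zero u hu := by
    rw [DurrmeyerSampling.boxAverage, intervalIntegral.integral_congr (g := fun _ => (0 : ℝ))]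
    · simp
    · intro v hv
      exact h.eq_zero v (by linarith [(abs_le_of_mem_uIcc_box hv).2])
  sum_eq_one u N hN := by
    simp_rw [boxAverage_sub_int]
    rw [← intervalIntegral.integral_finsetSum, intervalIntegral.integral_congr (g := fun _ => 1)]
    · simp
      ring
    · intro v hv
      exact h.sum_eq_one v N (by linarith [(abs_le_of_mem_uIcc_box hv).1])
    · intro k _
      exact (h.continuous.comp (continuous_sub_right _)).intervalIntegrable _ _
  sum_mul_eq u N hN := by
    simp_rw [boxAverage_sub_int, ← intervalIntegral.integral_const_mul]
    rw [← intervalIntegral.integral_finsetSum, intervalIntegral.integral_congr (g := fun v => v)]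
    · simp
      ring
    · intro v hv
      exact h.sum_mul_eq v N (by linarith [(abs_le_of_mem_uIcc_box hv).1])
    · intro k _
      exact ((h.continuous.comp (continuous_sub_right _)).const_mul _).intervalIntegrable _ _

/-- Truncated powers of exponent at least two are differentiable, also at the knot. -/
lemma hasDerivAt_posPart_pow {m : ℕ} (hm : 1 ≤ m) (v : ℝ) :
    HasDerivAt (fun x : ℝ => max x 0 ^ (m + 1)) ((m + 1) * max v 0 ^ m) v := by
  rcases lt_trichotomy v 0 with hv | rfl | hv
  · have : (fun x : ℝ => max x 0 ^ (m + 1)) =ᶠ[𝓝 v] fun _ => 0 := by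
      filter_upwards [gt_mem_nhds hv] with x hx
      simp [max_eq_right hx.le]
    rw [max_eq_right hv.le, zero_pow (by omega), mul_zero]
    exact (hasDerivAt_const v (0 : ℝ)).congr_of_eventuallyEq this
  · rw [max_self, zero_pow (by omega), mul_zero, hasDerivAt_iff_tendsto_slope]
    have hc : Tendsto (fun x : ℝ => max x 0 ^ m) (𝓝[≠] 0) (𝓝 0) := by
      have : Continuous fun x : ℝ => max x 0 ^ m := by fun_prop
      have := this.tendsto 0
      simp only [max_self, zero_pow (show m ≠ 0 by omega)] at this
      exact this.mono_left nhdsWithin_le_nhds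
    refine hc.congr' ?_
    filter_upwards [self_mem_nhdsWithin] with x hx
    have hx : x ≠ 0 := hx
    rw [slope_def_field, max_self, zero_pow (by omega), sub_zero, sub_zero, eq_div_iff hx, pow_succ]
    rcases le_total x 0 with h | h
    · simp [max_eq_right h, zero_pow (show m ≠ 0 by omega)]
    · rw [max_eq_left h]
  · have : (fun x : ℝ => max x 0 ^ (m + 1)) =ᶠ[𝓝 v] fun x => x ^ (m + 1) := by
      filter_upwards [lt_mem_nhds hv] with x hx
      rw [max_eq_left hx.le]
    rw [max_eq_left hv.le]
    have h := hasDerivAt_pow (m + 1) v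
    simp only [Nat.add_sub_cancel, Nat.cast_add, Nat.cast_one] at h
    exact h.congr_of_eventuallyEq this

lemma integral_posPart_pow {m : ℕ} (hm : 1 ≤ m) (a b : ℝ) :
    ∫ v in a..b, max v 0 ^ m = (max b 0 ^ (m + 1) - max a 0 ^ (m + 1)) / (m + 1) := by
  have hm0 : (m + 1 : ℝ) ≠ 0 := by positivity
  have h := intervalIntegral.integral_eq_sub_of_hasDerivAt
    (fun v _ => hasDerivAt_posPart_pow hm v)
    ((by fun_prop : Continuous fun v : ℝ => (m + 1 : ℝ) * max v 0 ^ m).intervalIntegrable a b)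
  rw [intervalIntegral.integral_const_mul] at h
  rw [eq_div_iff hm0, mul_comm, h]

/-- Pascal's rule in the form: the `(n+1)`-st backward difference is the first difference of the
`n`-th one. -/
lemma sum_alternating_choose_succ (g : ℕ → ℝ) (n : ℕ) :
    ∑ j ∈ Finset.range (n + 2), (-1 : ℝ) ^ j * ((n + 1).choose j : ℝ) * g j =
      ∑ j ∈ Finset.range (n + 1), (-1 : ℝ) ^ j * (n.choose j : ℝ) * (g j - g (j + 1)) := by
  have h : ∑ j ∈ Finset.range (n + 1), (-1 : ℝ) ^ j * (n.choose j : ℝ) * g j =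
      ∑ j ∈ Finset.range (n + 1), (-1 : ℝ) ^ (j + 1) * (n.choose (j + 1) : ℝ) * g (j + 1) + g 0 := by
    have h1 := Finset.sum_range_succ (fun j => (-1 : ℝ) ^ j * (n.choose j : ℝ) * g j) (n + 1)
    rw [Finset.sum_range_succ'] at h1
    simpa using h1.symm
  simp_rw [mul_sub]
  rw [Finset.sum_sub_distrib, h, Finset.sum_range_succ', add_sub_right_comm,
    ← Finset.sum_sub_distrib]
  congr 1
  · refine Finset.sum_congr rfl fun j _ => ?_
    rw [Nat.choose_succ_succ]
    push_cast
    ring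
  · simp

lemma centralBSpline_succ {n : ℕ} (hn : 2 ≤ n) :
    centralBSpline (n + 1) = boxAverage (centralBSpline n) := by
  obtain ⟨m, rfl⟩ : ∃ m, n = m + 1 := ⟨n - 1, by omega⟩
  have hm : 1 ≤ m := by omega
  funext u
  unfold boxAverage centralBSpline
  rw [intervalIntegral.integral_const_mul, intervalIntegral.integral_finsetSum]
  · have key : ∀ j : ℕ, ∫ v in (u - 1 / 2)..(u + 1 / 2), (-1 : ℝ) ^ j * ((m + 1).choose j : ℝ) *
        max (((m + 1 : ℕ) : ℝ) / 2 + v - j) 0 ^ m =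
        1 / (m + 1) * ((-1 : ℝ) ^ j * ((m + 1).choose j : ℝ) *
          (max (((m + 1 + 1 : ℕ) : ℝ) / 2 + u - j) 0 ^ (m + 1) -
            max (((m + 1 + 1 : ℕ) : ℝ) / 2 + u - (j + 1 : ℕ)) 0 ^ (m + 1))) := by
      intro j
      rw [intervalIntegral.integral_const_mul]
      have e : ∀ v : ℝ, ((m + 1 : ℕ) : ℝ) / 2 + v - j = v + (((m + 1 : ℕ) : ℝ) / 2 - j) :=
        fun v => by ring
      simp_rw [e]
      rw [intervalIntegral.integral_comp_add_right (fun v : ℝ => max v 0 ^ m),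
        integral_posPart_pow hm]
      have e1 : u + 1 / 2 + (((m + 1 : ℕ) : ℝ) / 2 - j) = ((m + 1 + 1 : ℕ) : ℝ) / 2 + u - j := by
        push_cast; ring
      have e2 : u - 1 / 2 + (((m + 1 : ℕ) : ℝ) / 2 - j) =
          ((m + 1 + 1 : ℕ) : ℝ) / 2 + u - (j + 1 : ℕ) := by
        push_cast; ring
      rw [e1, e2]
      ring
    simp only [Nat.add_sub_cancel]
    simp_rw [key]
    rw [← Finset.mul_sum, sum_alternating_choose_succ, ← mul_assoc, Nat.factorial_succ]
    congr 1
    push_cast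
    field_simp
  · intro j _
    exact (by fun_prop : Continuous _).intervalIntegrable _ _

lemma centralBSpline_two (u : ℝ) : centralBSpline 2 u = max (1 - |u|) 0 := by
  have h : centralBSpline 2 u = max (1 + u) 0 - 2 * max u 0 + max (u - 1) 0 := by
    simp [centralBSpline, Finset.sum_range_succ]
    ring_nf
  rw [h]
  rcases abs_cases u with ⟨h1, h2⟩ | ⟨h1, h2⟩ <;> rw [h1] <;>
    rcases le_total (1 + u) 0 with h3 | h3 <;> rcases le_total u 0 with h4 | h4 <;>
    rcases le_total (u - 1) 0 with h5 | h5 <;> simp only [h3, h4, h5, max_eq_left, max_eq_right] <;>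
    first
    | (rw [max_eq_left (by linarith)]; linarith)
    | (rw [max_eq_right (by linarith)]; linarith)

lemma isSplineKernel_centralBSpline_two : IsSplineKernel (centralBSpline 2) 1 := by
  -- Only the translates by `⌊u⌋` and `⌊u⌋ + 1` do not vanish at `u`.
  have key : ∀ (c : ℤ → ℝ) (u : ℝ) (N : ℕ), |u| + 1 ≤ N →
      ∑ k ∈ Finset.Icc (-N : ℤ) N, c k * centralBSpline 2 (u - k) =
        c ⌊u⌋ * (1 - Int.fract u) + c (⌊u⌋ + 1) * Int.fract u := by
    intro c u N hN
    have hfl := Int.floor_le u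
    have hlt := Int.lt_floor_add_one u
    have hfr : Int.fract u = u - ⌊u⌋ := rfl
    have hle := le_abs_self u
    have hge := neg_abs_le u
    have hsub : ({⌊u⌋, ⌊u⌋ + 1} : Finset ℤ) ⊆ Finset.Icc (-N : ℤ) N := by
      have h1 : (-N : ℤ) ≤ ⌊u⌋ := Int.le_floor.2 (by push_cast; linarith)
      have h2 : ⌊u⌋ + 1 ≤ (N : ℤ) := by
        have : (⌊u⌋ : ℝ) + 1 ≤ N := by linarith
        exact_mod_cast this
      intro k hk
      simp only [Finset.mem_insert, Finset.mem_singleton] at hk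
      rw [Finset.mem_Icc]
      omega
    rw [← Finset.sum_subset hsub, Finset.sum_pair (by omega), centralBSpline_two,
      centralBSpline_two, hfr]
    · rw [abs_of_nonneg (by linarith), max_eq_left (by linarith),
        abs_of_nonpos (by push_cast; linarith), max_eq_left (by push_cast; linarith)]
      push_cast
      ring
    · intro k _ hk
      simp only [Finset.mem_insert, Finset.mem_singleton, not_or] at hk
      rw [centralBSpline_two, max_eq_right, mul_zero]
      rcases lt_or_gt_of_ne hk.1 with h | h
      · have : (k : ℝ) + 1 ≤ ⌊u⌋ := by exact_mod_cast h
        linarith [le_abs_self (u - k)]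
      · have : (⌊u⌋ : ℝ) + 1 + 1 ≤ k := by
          have : ⌊u⌋ + 1 + 1 ≤ k := by omega
          exact_mod_cast this
        linarith [neg_abs_le (u - k)]
  constructor
  · have : centralBSpline 2 = fun u : ℝ => max (1 - |u|) 0 := funext centralBSpline_two
    rw [this]
    fun_prop
  · intro u
    rw [centralBSpline_two]
    exact le_max_right _ _
  · intro u
    rw [centralBSpline_two, centralBSpline_two, abs_neg]
  · intro u hu
    rw [centralBSpline_two, max_eq_right (by linarith)]
  · intro u N hN
    have := key (fun _ => 1) u N hN
    simp only [one_mul] at this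
    rw [this]
    ring
  · intro u N hN
    rw [key (fun k => (k : ℝ)) u N hN]
    push_cast
    have := Int.floor_add_fract u
    linear_combination this

/-- The central B-spline of order `n ≥ 2` is a spline kernel, by induction from the hat function. -/
lemma isSplineKernel_centralBSpline {n : ℕ} (hn : 2 ≤ n) :
    IsSplineKernel (centralBSpline n) (n / 2) := by
  induction n, hn using Nat.le_induction with
  | base => simpa using isSplineKernel_centralBSpline_two
  | succ n hn ih =>
    rw [centralBSpline_succ hn]
    convert ih.boxAverage using 1
    push_cast
    ring

namespace IsSplineKernel

variable {σ : ℝ → ℝ} {R : ℝ}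

lemma radius_pos (h : IsSplineKernel σ R) : 0 < R := by
  by_contra hR
  obtain ⟨N, hN⟩ := exists_nat_ge (|(0 : ℝ)| + R)
  have := h.sum_eq_one 0 N hN
  rw [Finset.sum_eq_zero fun k _ => h.eq_zero _ (le_trans (not_lt.1 hR) (abs_nonneg _))] at this
  exact zero_ne_one this

lemma eq_zero_of_notMem (h : IsSplineKernel σ R) {u : ℝ} {N : ℕ} (hN : |u| + R ≤ N) {k : ℤ}
    (hk : k ∉ Finset.Icc (-N : ℤ) N) : σ (u - k) = 0 := by
  apply h.eq_zero
  have hk' : (N : ℤ) < |k| := by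
    by_contra hc
    exact hk (Finset.mem_Icc.2 (abs_le.1 (not_lt.1 hc)))
  have hk'' : (N : ℝ) < |(k : ℝ)| := by exact_mod_cast hk'
  have := abs_sub_abs_le_abs_sub (k : ℝ) u
  rw [abs_sub_comm] at this
  linarith

lemma hasSum_mul (h : IsSplineKernel σ R) (c : ℤ → ℝ) {u : ℝ} {N : ℕ} (hN : |u| + R ≤ N) :
    HasSum (fun k : ℤ => σ (u - k) * c k) (∑ k ∈ Finset.Icc (-N : ℤ) N, σ (u - k) * c k) :=
  hasSum_sum_of_ne_finset_zero fun k hk => by rw [h.eq_zero_of_notMem hN hk, zero_mul]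

lemma hasSum_one (h : IsSplineKernel σ R) (u : ℝ) : HasSum (fun k : ℤ => σ (u - k)) 1 := by
  obtain ⟨N, hN⟩ := exists_nat_ge (|u| + R)
  rw [← h.sum_eq_one u N hN]
  simpa using h.hasSum_mul (fun _ => 1) hN

lemma hasSum_id (h : IsSplineKernel σ R) (u : ℝ) :
    HasSum (fun k : ℤ => σ (u - k) * (k : ℝ)) u := by
  obtain ⟨N, hN⟩ := exists_nat_ge (|u| + R)
  have := h.hasSum_mul (fun k => (k : ℝ)) hN
  simp_rw [mul_comm (σ _)] at this ⊢
  rwa [h.sum_mul_eq u N hN] at this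

lemma le_one (h : IsSplineKernel σ R) (u : ℝ) : σ u ≤ 1 := by
  have := le_hasSum (h.hasSum_one u) 0 fun k _ => h.nonneg _
  simpa using this

lemma hasCompactSupport (h : IsSplineKernel σ R) : HasCompactSupport σ :=
  HasCompactSupport.of_support_subset_isCompact (isCompact_closedBall (0 : ℝ) R) fun u hu => by
    rw [mem_closedBall_zero_iff, Real.norm_eq_abs]
    by_contra hc
    exact hu (h.eq_zero u (not_le.1 hc).le)

lemma integrable (h : IsSplineKernel σ R) : Integrable σ :=
  h.continuous.integrable_of_hasCompactSupport h.hasCompactSupport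

/-- Integrating the partition of unity over `[0, 1]` gives the total mass of the kernel. -/
lemma integral_eq_one (h : IsSplineKernel σ R) : ∫ u, σ u = 1 := by
  have h1 := h.integrable.hasSum_intervalIntegral_comp_add_int
  obtain ⟨N, hN⟩ := exists_nat_ge (1 + R)
  have hz : ∀ x ∈ Set.uIcc (0 : ℝ) 1, |x| + R ≤ N := fun x hx => by
    rw [Set.uIcc_of_le zero_le_one] at hx
    rw [abs_of_nonneg hx.1]
    linarith [hx.2]
  have h2 : HasSum (fun n : ℤ => ∫ x in (0 : ℝ)..1, σ (x + n))
      (∑ n ∈ Finset.Icc (-N : ℤ) N, ∫ x in (0 : ℝ)..1, σ (x + n)) := by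
    refine hasSum_sum_of_ne_finset_zero fun n hn => ?_
    rw [intervalIntegral.integral_congr (g := fun _ => (0 : ℝ)), intervalIntegral.integral_zero]
    intro x hx
    have := h.eq_zero_of_notMem (hz x hx) (k := -n) (by
      simp only [Finset.mem_Icc] at hn ⊢
      omega)
    simpa using this
  rw [h1.unique h2, ← intervalIntegral.integral_finsetSum,
    intervalIntegral.integral_congr (g := fun _ => (1 : ℝ))]
  · simp
  · intro x hx
    have := h.sum_eq_one x N (hz x hx)
    rw [← this]
    refine Finset.sum_nbij' (fun k => -k) (fun k => -k) ?_ ?_ ?_ ?_ ?_ <;> intro k hk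
    · simp only [Finset.mem_Icc] at hk ⊢; omega
    · simp only [Finset.mem_Icc] at hk ⊢; omega
    · simp
    · simp
    · simp
  · intro k _
    exact (h.continuous.comp (continuous_add_const _)).intervalIntegrable _ _

lemma integral_mul_id_eq_zero (h : IsSplineKernel σ R) : ∫ u, σ u * u = 0 := by
  have h1 : ∫ u, σ (-u) * (-u) = ∫ u, σ u * u := integral_neg_eq_self (fun u => σ u * u) volume
  simp only [h.even, mul_neg, integral_neg] at h1
  linarith

lemma integrable_mul_id (h : IsSplineKernel σ R) : Integrable fun u => σ u * u :=
  (h.continuous.mul continuous_id).integrable_of_hasCompactSupport h.hasCompactSupport.mul_right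

end IsSplineKernel

section

/-! ### The norm of nonnegative functions and the integral Minkowski inequality -/

/-- The norm of `L^p(ℝ)` on functions with values in `[0, ∞]`; for `p = ∞` it is the (genuine)
supremum, so that `normLp p f` is the size of `x ↦ ‖f x‖ₑ` for every `1 ≤ p ≤ ∞`. -/
def lpSize (p : ℝ≥0∞) (g : ℝ → ℝ≥0∞) : ℝ≥0∞ :=
  if p = ∞ then ⨆ x, g x else (∫⁻ x, g x ^ p.toReal) ^ (1 / p.toReal)

variable {p : ℝ≥0∞}

lemma normLp_eq_lpSize (hp : 1 ≤ p) (f : ℝ → ℝ) : normLp p f = lpSize p fun x => ‖f x‖ₑ := by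
  unfold normLp lpSize
  split_ifs with h
  · rfl
  · rw [eLpNorm_eq_lintegral_rpow_enorm_toReal (zero_lt_one.trans_le hp).ne' h]

lemma lpSize_mono {g₁ g₂ : ℝ → ℝ≥0∞} (h : ∀ x, g₁ x ≤ g₂ x) : lpSize p g₁ ≤ lpSize p g₂ := by
  unfold lpSize
  split_ifs
  · exact iSup_mono h
  · gcongr with x
    exact h x

lemma one_le_toReal (hp : 1 ≤ p) (h : p ≠ ∞) : 1 ≤ p.toReal := by
  simpa using ENNReal.toReal_mono h hp

lemma lpSize_add_le (hp : 1 ≤ p) {g₁ g₂ : ℝ → ℝ≥0∞} (h₁ : Measurable g₁) (h₂ : Measurable g₂) :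
    lpSize p (fun x => g₁ x + g₂ x) ≤ lpSize p g₁ + lpSize p g₂ := by
  unfold lpSize
  split_ifs with h
  · exact iSup_le fun x => add_le_add (le_iSup g₁ x) (le_iSup g₂ x)
  · exact ENNReal.lintegral_Lp_add_le h₁.aemeasurable h₂.aemeasurable (one_le_toReal hp h)

lemma lpSize_const_mul (hp : 1 ≤ p) (c : ℝ≥0∞) {g : ℝ → ℝ≥0∞} (hg : Measurable g) :
    lpSize p (fun x => c * g x) = c * lpSize p g := by
  unfold lpSize
  split_ifs with h
  · rw [ENNReal.mul_iSup]
  · have hr : 0 < p.toReal := zero_lt_one.trans_le (one_le_toReal hp h)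
    simp_rw [ENNReal.mul_rpow_of_nonneg _ _ hr.le]
    rw [lintegral_const_mul _ (hg.pow_const _), ENNReal.mul_rpow_of_nonneg _ _ (by positivity),
      ← ENNReal.rpow_mul, mul_one_div_cancel hr.ne', ENNReal.rpow_one]

lemma lpSize_comp_add_right (g : ℝ → ℝ≥0∞) (a : ℝ) :
    lpSize p (fun x => g (x + a)) = lpSize p g := by
  unfold lpSize
  split_ifs with h
  · exact (Equiv.addRight a).iSup_comp (g := g)
  · rw [lintegral_add_right_eq_self (fun x => g x ^ p.toReal) a]

lemma lintegral_rpow_le {r : ℝ} (hr : 1 ≤ r) {S : Set ℝ} {g : ℝ → ℝ≥0∞} (hg : Measurable g) :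
    (∫⁻ s in S, g s) ^ r ≤ (∫⁻ s in S, g s ^ r) * volume S ^ (r - 1) := by
  have hr0 : 0 < r := zero_lt_one.trans_le hr
  have h := eLpNorm'_le_eLpNorm'_mul_rpow_measure_univ (μ := volume.restrict S) zero_lt_one hr
    hg.aestronglyMeasurable
  simp only [eLpNorm'_eq_lintegral_enorm, enorm_eq_self, ENNReal.rpow_one, div_one,
    Measure.restrict_apply_univ] at h
  have h2 := ENNReal.rpow_le_rpow h hr0.le
  rw [ENNReal.mul_rpow_of_nonneg _ _ hr0.le, ← ENNReal.rpow_mul, ← ENNReal.rpow_mul,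
    one_div_mul_cancel hr0.ne', ENNReal.rpow_one, sub_mul, one_div_mul_cancel hr0.ne', one_mul] at h2
  exact h2

/-- Minkowski's integral inequality, with the integrand of uniformly bounded size. For `p < ∞` it
is Jensen's inequality in `s` followed by Tonelli's theorem. -/
lemma lpSize_setLIntegral_le (hp : 1 ≤ p) {S : Set ℝ}
    {F : ℝ → ℝ → ℝ≥0∞} (hF : Measurable (Function.uncurry F)) {A : ℝ≥0∞}
    (hA : ∀ s ∈ S, lpSize p (fun x => F x s) ≤ A) :
    lpSize p (fun x => ∫⁻ s in S, F x s) ≤ volume S * A := by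
  unfold lpSize at hA ⊢
  split_ifs at hA ⊢ with h
  · refine iSup_le fun x => ?_
    calc ∫⁻ s in S, F x s ≤ ∫⁻ s in S, A :=
          setLIntegral_mono measurable_const fun s hs => (le_iSup (fun x => F x s) x).trans (hA s hs)
      _ = volume S * A := by rw [setLIntegral_const, mul_comm]
  · have hr := one_le_toReal hp h
    set r := p.toReal
    have hr0 : 0 < r := zero_lt_one.trans_le hr
    have hFr : Measurable (Function.uncurry fun x s => F x s ^ r) := hF.pow_const r
    have key : ∫⁻ x, (∫⁻ s in S, F x s) ^ r ≤ (volume S * A) ^ r := by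
      calc ∫⁻ x, (∫⁻ s in S, F x s) ^ r
          ≤ ∫⁻ x, (∫⁻ s in S, F x s ^ r) * volume S ^ (r - 1) :=
            lintegral_mono fun x => lintegral_rpow_le hr (hF.of_uncurry_left)
        _ = (∫⁻ s in S, ∫⁻ x, F x s ^ r) * volume S ^ (r - 1) := by
            have hm : Measurable fun x => ∫⁻ s in S, F x s ^ r := hFr.lintegral_prod_right'
            rw [lintegral_mul_const _ hm, lintegral_lintegral_swap hFr.aemeasurable]
        _ ≤ (∫⁻ _ in S, A ^ r) * volume S ^ (r - 1) := by
            gcongr 1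
            refine setLIntegral_mono measurable_const fun s hs => ?_
            have := ENNReal.rpow_le_rpow (hA s hs) hr0.le
            rwa [← ENNReal.rpow_mul, one_div_mul_cancel hr0.ne', ENNReal.rpow_one] at this
        _ = (volume S * A) ^ r := by
            rw [setLIntegral_const, ENNReal.mul_rpow_of_nonneg _ _ hr0.le, mul_assoc, mul_comm]
            congr 1
            nth_rewrite 1 [← ENNReal.rpow_one (volume S)]
            rw [← ENNReal.rpow_add_of_nonneg _ _ zero_le_one (by linarith), add_sub_cancel]
    have := ENNReal.rpow_le_rpow key (by positivity : 0 ≤ 1 / r)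
    rwa [← ENNReal.rpow_mul, mul_one_div_cancel hr0.ne', ENNReal.rpow_one] at this

/-- Two functions representing the same element of the space `InLp p`: equal almost everywhere, and
everywhere if `p = ∞`. -/
def LpEq (p : ℝ≥0∞) (f g : ℝ → ℝ) : Prop := f =ᵐ[volume] g ∧ (p = ∞ → f = g)

lemma LpEq.normLp_eq {f g : ℝ → ℝ} (h : LpEq p f g) : normLp p f = normLp p g := by
  unfold normLp
  split_ifs with hp
  · rw [h.2 hp]
  · exact eLpNorm_congr_ae h.1

lemma LpEq.comp_add_right {f g : ℝ → ℝ} (h : LpEq p f g) (a : ℝ) :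
    (fun x => f (x + a)) =ᵐ[volume] fun x => g (x + a) :=
  (measurePreserving_add_right volume a).quasiMeasurePreserving.ae_eq_comp h.1

lemma LpEq.finDiff {f g : ℝ → ℝ} (h : LpEq p f g) (r : ℕ) (t : ℝ) :
    LpEq p (finDiff r t f) (finDiff r t g) := by
  refine ⟨?_, fun hp => by rw [h.2 hp]⟩
  have : ∀ᵐ x, ∀ j : ℕ, f (x + j * t) = g (x + j * t) :=
    ae_all_iff.2 fun j => h.comp_add_right (j * t)
  filter_upwards [this] with x hx
  simp only [DurrmeyerSampling.finDiff, hx]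

lemma LpEq.modulus_eq {f g : ℝ → ℝ} (h : LpEq p f g) (r : ℕ) (δ : ℝ) :
    modulus r p f δ = modulus r p g δ := by
  unfold modulus
  simp_rw [fun t => (h.finDiff r t).normLp_eq]

lemma InLp.exists_measurable_lpEq {f : ℝ → ℝ} (hf : InLp p f) :
    ∃ g, Measurable g ∧ LpEq p f g := by
  unfold InLp at hf
  split_ifs at hf with h
  · exact ⟨f, hf.1.continuous.measurable, EventuallyEq.rfl, fun _ => rfl⟩
  · obtain ⟨g, hg, hfg⟩ := hf.1.aemeasurable
    exact ⟨g, hg, hfg, fun hp => absurd hp h⟩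

lemma InLp.congr {f g : ℝ → ℝ} (hf : InLp p f) (h : LpEq p f g) : InLp p g := by
  unfold InLp at hf ⊢
  split_ifs at hf ⊢ with hp
  · rwa [← h.2 hp]
  · exact (memLp_congr_ae h.1).1 hf

lemma InLp.locallyIntegrable (hp : 1 ≤ p) {f : ℝ → ℝ} (hf : InLp p f) :
    LocallyIntegrable f := by
  unfold InLp at hf
  split_ifs at hf with h
  · exact hf.1.continuous.locallyIntegrable
  · exact hf.locallyIntegrable hp

lemma finDiff_measurable {f : ℝ → ℝ} (hf : Measurable f) (r : ℕ) :
    Measurable fun z : ℝ × ℝ => finDiff r z.2 f z.1 := by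
  unfold finDiff
  fun_prop

lemma finDiff_one (t : ℝ) (f : ℝ → ℝ) (x : ℝ) : finDiff 1 t f x = f (x + t) - f x := by
  simp [finDiff, Finset.sum_range_succ]
  ring

lemma finDiff_two (t : ℝ) (f : ℝ → ℝ) (x : ℝ) :
    finDiff 2 t f x = f (x + 2 * t) - 2 * f (x + t) + f x := by
  simp [finDiff, Finset.sum_range_succ]
  ring

lemma normLp_finDiff_le_modulus (r : ℕ) (f : ℝ → ℝ) {t δ : ℝ} (ht : |t| ≤ δ) :
    normLp p (finDiff r t f) ≤ modulus r p f δ :=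
  le_iSup₂ (f := fun t (_ : |t| ≤ δ) => normLp p (finDiff r t f)) t ht

end

lemma _root_.MeasureTheory.LocallyIntegrable.intervalIntegrable {f : ℝ → ℝ}
    (hf : LocallyIntegrable f) (a b : ℝ) : IntervalIntegrable f volume a b :=
  (hf.integrableOn_isCompact isCompact_uIcc).intervalIntegrable

/-! ### The Durrmeyer operator of a spline kernel -/

namespace IsSplineKernel

variable {σ : ℝ → ℝ} {R w : ℝ}

lemma integral_comp_dilate_translate (hw : 0 < w) (g : ℝ → ℝ) (k : ℝ) :
    w * ∫ u, g (w * u - k) = ∫ v, g v := by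
  rw [Measure.integral_comp_mul_left (fun v => g (v - k)), integral_sub_right_eq_self,
    abs_of_pos (inv_pos.2 hw), smul_eq_mul, mul_inv_cancel_left₀ hw.ne']

lemma hasCompactSupport_dilate (h : IsSplineKernel σ R) (hw : 0 < w) (k : ℝ) :
    HasCompactSupport fun u => σ (w * u - k) :=
  HasCompactSupport.of_support_subset_isCompact (isCompact_closedBall (k / w) (R / w))
    fun u hu => by
      rw [Metric.mem_closedBall, Real.dist_eq, le_div_iff₀ hw]
      by_contra hc
      refine hu (h.eq_zero _ ?_)
      calc R ≤ |u - k / w| * w := (not_le.1 hc).le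
        _ = |w * u - k| := by
          rw [← abs_of_pos hw, ← abs_mul, abs_of_pos hw]
          congr 1
          field_simp

lemma integrable_dilate_mul (h : IsSplineKernel σ R) (hw : 0 < w) {f : ℝ → ℝ}
    (hf : LocallyIntegrable f) (k : ℝ) : Integrable fun u => σ (w * u - k) * f u :=
  hf.integrable_smul_left_of_hasCompactSupport (h.continuous.comp (by fun_prop))
    (h.hasCompactSupport_dilate hw k)

lemma summable_mul (h : IsSplineKernel σ R) (c : ℤ → ℝ) (u : ℝ) :
    Summable fun k : ℤ => σ (u - k) * c k := by
  obtain ⟨N, hN⟩ := exists_nat_ge (|u| + R)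
  exact (h.hasSum_mul c hN).summable

lemma durrmeyerConverges (h : IsSplineKernel σ R) (hw : 0 < w) {f : ℝ → ℝ}
    (hf : LocallyIntegrable f) : DurrmeyerConverges σ σ w f :=
  ⟨fun k => h.integrable_dilate_mul hw hf k, fun _ => h.summable_mul _ _⟩

lemma durrmeyer_add (h : IsSplineKernel σ R) (hw : 0 < w) {f g : ℝ → ℝ}
    (hf : LocallyIntegrable f) (hg : LocallyIntegrable g) (x : ℝ) :
    durrmeyer σ σ w (fun u => f u + g u) x = durrmeyer σ σ w f x + durrmeyer σ σ w g x := by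
  unfold durrmeyer
  rw [← (h.summable_mul _ _).tsum_add (h.summable_mul _ _)]
  refine tsum_congr fun k => ?_
  simp_rw [mul_add]
  rw [integral_add (h.integrable_dilate_mul hw hf k) (h.integrable_dilate_mul hw hg k)]
  ring

/-- The operator reproduces affine functions; it suffices to expand them around `x`. -/
lemma durrmeyer_affine (h : IsSplineKernel σ R) (hw : 0 < w) (a b x : ℝ) :
    durrmeyer σ σ w (fun u => a + b * (u - x)) x = a := by
  have hcoef : ∀ k : ℤ, w * ∫ u, σ (w * u - k) * (a + b * (u - x)) =
      (a - b * x) + b / w * k := by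
    intro k
    have e : ∀ u : ℝ, σ (w * u - k) * (a + b * (u - x)) =
        (fun v => (a + b * (k / w - x)) * σ v + b / w * (σ v * v)) (w * u - k) := by
      intro u
      simp only
      field_simp
      ring
    simp_rw [e]
    rw [integral_comp_dilate_translate hw
        (fun v => (a + b * (k / w - x)) * σ v + b / w * (σ v * v)),
      integral_add (h.integrable.const_mul _) (h.integrable_mul_id.const_mul _),
      integral_const_mul, integral_const_mul, h.integral_eq_one, h.integral_mul_id_eq_zero]
    ring
  have hs : HasSum (fun k : ℤ => σ (w * x - k) * ((a - b * x) + b / w * k))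
      (1 * (a - b * x) + w * x * (b / w)) := by
    refine (((h.hasSum_one (w * x)).mul_right (a - b * x)).add
      ((h.hasSum_id (w * x)).mul_right (b / w))).congr_fun ?_
    intro k
    ring
  unfold durrmeyer
  simp_rw [hcoef]
  rw [hs.tsum_eq]
  field_simp
  ring

/-- The value at `x` only depends on `f` near `x`: the kernel `w ∑ₖ σ(wx - k) σ(wu - k)` is bounded
by `w` and vanishes for `|u - x| > 2R/w`. -/
lemma abs_durrmeyer_le (h : IsSplineKernel σ R) (hw : 0 < w) {f : ℝ → ℝ}
    (hf : LocallyIntegrable f) (x : ℝ) :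
    |durrmeyer σ σ w f x| ≤ w * ∫ u in (x - 2 * R / w)..(x + 2 * R / w), |f u| := by
  have hR := h.radius_pos
  have hρ : 0 < 2 * R / w := by positivity
  set M := w * ∫ u in (x - 2 * R / w)..(x + 2 * R / w), |f u| with hM
  have hbd : ∀ k : ℤ, ‖σ (w * x - k) * (w * ∫ u, σ (w * u - k) * f u)‖ ≤ σ (w * x - k) * M := by
    intro k
    rw [norm_mul, Real.norm_of_nonneg (h.nonneg _)]
    by_cases hk : σ (w * x - k) = 0
    · simp [hk]
    refine mul_le_mul_of_nonneg_left ?_ (h.nonneg _)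
    rw [norm_mul, Real.norm_of_nonneg hw.le, hM]
    refine mul_le_mul_of_nonneg_left ?_ hw.le
    have hkR : |w * x - k| < R := by
      by_contra hc
      exact hk (h.eq_zero _ (not_lt.1 hc))
    have hint : IntegrableOn (fun u => |f u|) (Set.Ioc (x - 2 * R / w) (x + 2 * R / w)) :=
      ((hf.integrableOn_isCompact isCompact_Icc).mono_set Set.Ioc_subset_Icc_self).norm
    rw [intervalIntegral.integral_of_le (by linarith), ← integral_indicator measurableSet_Ioc]
    refine norm_integral_le_of_norm_le (hint.integrable_indicator measurableSet_Ioc)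
      (ae_of_all _ fun u => ?_)
    by_cases hu : σ (w * u - k) = 0
    · rw [hu, zero_mul, norm_zero]
      exact Set.indicator_nonneg (fun _ _ => abs_nonneg _) _
    · have huR : |w * u - k| < R := by
        by_contra hc
        exact hu (h.eq_zero _ (not_lt.1 hc))
      have hmem : u ∈ Set.Ioc (x - 2 * R / w) (x + 2 * R / w) := by
        rw [abs_lt] at hkR huR
        have e : w * (2 * R / w) = 2 * R := by field_simp
        constructor
        · refine lt_of_mul_lt_mul_left (a := w) ?_ hw.le
          rw [mul_sub, e]
          linarith
        · refine le_of_mul_le_mul_left (a := w) ?_ hw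
          rw [mul_add, e]
          linarith
      rw [Set.indicator_of_mem hmem, norm_mul, Real.norm_of_nonneg (h.nonneg _),
        Real.norm_eq_abs]
      exact mul_le_of_le_one_left (abs_nonneg _) (h.le_one _)
  have := tsum_of_norm_bounded ((h.hasSum_one (w * x)).mul_right M) hbd
  rwa [one_mul] at this

lemma enorm_durrmeyer_le (h : IsSplineKernel σ R) (hw : 0 < w) {f : ℝ → ℝ}
    (hf : LocallyIntegrable f) (x : ℝ) :
    ‖durrmeyer σ σ w f x‖ₑ ≤ ENNReal.ofReal w *
      ∫⁻ s in Set.Ioc (-(2 * R / w)) (2 * R / w), ‖f (x + s)‖ₑ := by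
  have hR := h.radius_pos
  have hρ : 0 < 2 * R / w := by positivity
  have hint : IntegrableOn (fun s => f (x + s)) (Set.Ioc (-(2 * R / w)) (2 * R / w)) := by
    have h1 : IntervalIntegrable f volume (x + -(2 * R / w)) (x + 2 * R / w) :=
      hf.intervalIntegrable _ _
    have h2 := h1.comp_add_left x
    simp only [add_sub_cancel_left] at h2
    exact (intervalIntegrable_iff_integrableOn_Ioc_of_le (by linarith)).1 h2
  have h1 := h.abs_durrmeyer_le hw hf x
  have h2 := intervalIntegral.integral_comp_add_left (a := -(2 * R / w)) (b := 2 * R / w)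
    (fun u => |f u|) x
  rw [← sub_eq_add_neg] at h2
  rw [← h2, intervalIntegral.integral_of_le (by linarith)] at h1
  rw [← ofReal_integral_norm_eq_lintegral_enorm hint, ← ENNReal.ofReal_mul hw.le,
    Real.enorm_eq_ofReal_abs]
  exact ENNReal.ofReal_le_ofReal h1

lemma continuous_tsum_mul (h : IsSplineKernel σ R) (c : ℤ → ℝ) :
    Continuous fun u => ∑' k : ℤ, σ (u - k) * c k := by
  rw [continuous_iff_continuousAt]
  intro u₀
  obtain ⟨N, hN⟩ := exists_nat_ge (|u₀| + 1 + R)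
  have hev : (fun u => ∑' k : ℤ, σ (u - k) * c k) =ᶠ[𝓝 u₀]
      fun u => ∑ k ∈ Finset.Icc (-N : ℤ) N, σ (u - k) * c k := by
    have hc : ∀ᶠ u in 𝓝 u₀, |u| < |u₀| + 1 :=
      continuous_abs.continuousAt.eventually_lt continuousAt_const (lt_add_one _)
    filter_upwards [hc] with u hu
    exact (h.hasSum_mul c (by linarith)).tsum_eq
  have hcont : Continuous fun u => ∑ k ∈ Finset.Icc (-N : ℤ) N, σ (u - k) * c k :=
    continuous_finsetSum _ fun k _ =>
      (h.continuous.comp (continuous_id.sub continuous_const)).mul continuous_const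
  exact hcont.continuousAt.congr hev.symm

lemma continuous_durrmeyer (h : IsSplineKernel σ R) (f : ℝ → ℝ) :
    Continuous (durrmeyer σ σ w f) :=
  (h.continuous_tsum_mul fun k => w * ∫ u, σ (w * u - k) * f u).comp (continuous_const_mul w)

/-- If `|a - b| < 1`, at most `2R + 3` terms of the two series differ. -/
lemma uniformContinuous_tsum_mul (h : IsSplineKernel σ R) {c : ℤ → ℝ} {A : ℝ}
    (hc : ∀ k, |c k| ≤ A) : UniformContinuous fun u => ∑' k : ℤ, σ (u - k) * c k := by
  have hR := h.radius_pos
  have hA : 0 ≤ A := (abs_nonneg _).trans (hc 0)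
  have hσ := h.hasCompactSupport.uniformContinuous_of_continuous h.continuous
  rw [Metric.uniformContinuous_iff] at hσ ⊢
  intro ε hε
  have hK : 0 < (2 * R + 3) * (A + 1) := by positivity
  obtain ⟨δ, hδ, hσδ⟩ := hσ (ε / ((2 * R + 3) * (A + 1))) (by positivity)
  refine ⟨min δ 1, by positivity, fun a b hab => ?_⟩
  set η := ε / ((2 * R + 3) * (A + 1)) with hη
  have hη0 : 0 < η := by positivity
  have hab1 : |a - b| < 1 := (Real.dist_eq a b ▸ hab).trans_le (min_le_right _ _)
  set S := Finset.Icc ⌈a - (R + 1)⌉ ⌊a + (R + 1)⌋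
  have hcard : (S.card : ℝ) ≤ 2 * R + 3 := by
    have h1 : (S.card : ℤ) = max (⌊a + (R + 1)⌋ + 1 - ⌈a - (R + 1)⌉) 0 := by
      rw [Int.card_Icc, Int.toNat_eq_max]
    have h2 : (S.card : ℝ) = max ((⌊a + (R + 1)⌋ : ℝ) + 1 - ⌈a - (R + 1)⌉) 0 := by
      exact_mod_cast h1
    rw [h2]
    refine max_le ?_ (by linarith)
    linarith [Int.floor_le (a + (R + 1)), Int.le_ceil (a - (R + 1))]
  have hzero : ∀ k ∉ S, σ (a - k) * c k - σ (b - k) * c k = 0 := by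
    intro k hk
    have hak : R + 1 < |a - k| := by
      by_contra hcon
      rw [not_lt, abs_le] at hcon
      exact hk (Finset.mem_Icc.2 ⟨Int.ceil_le.2 (by linarith), Int.le_floor.2 (by linarith)⟩)
    have hbk : R ≤ |b - k| := by
      have := abs_sub_abs_le_abs_sub (a - k) (b - k)
      rw [sub_sub_sub_cancel_right] at this
      linarith
    rw [h.eq_zero _ (by linarith), h.eq_zero _ hbk, sub_self]
  rw [Real.dist_eq, ← (h.summable_mul c a).tsum_sub (h.summable_mul c b), tsum_eq_sum hzero]
  calc |∑ k ∈ S, (σ (a - k) * c k - σ (b - k) * c k)|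
      ≤ ∑ k ∈ S, |σ (a - k) * c k - σ (b - k) * c k| := Finset.abs_sum_le_sum_abs _ _
    _ ≤ ∑ k ∈ S, η * A := by
        refine Finset.sum_le_sum fun k _ => ?_
        rw [← sub_mul, abs_mul]
        refine mul_le_mul ?_ (hc k) (abs_nonneg _) hη0.le
        have hd : dist (a - k : ℝ) (b - k) < δ := by
          rw [dist_sub_right]
          exact hab.trans_le (min_le_left _ _)
        exact (hσδ hd).le
    _ = S.card * (η * A) := by rw [Finset.sum_const, nsmul_eq_mul]
    _ ≤ (2 * R + 3) * (η * A) := by gcongr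
    _ < (2 * R + 3) * (η * (A + 1)) := by gcongr; linarith
    _ = ε := by rw [hη]; field_simp

lemma uniformContinuous_durrmeyer (h : IsSplineKernel σ R) (hw : 0 < w) {f : ℝ → ℝ} {B : ℝ}
    (hB : ∀ x, |f x| ≤ B) : UniformContinuous (durrmeyer σ σ w f) := by
  have hcoef : ∀ k : ℤ, |w * ∫ u, σ (w * u - k) * f u| ≤ B := by
    intro k
    have hint : Integrable fun u => σ (w * u - k) * B :=
      ((h.continuous.comp (by fun_prop)).integrable_of_hasCompactSupport
        (h.hasCompactSupport_dilate hw k)).mul_const B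
    have h1 : ‖∫ u, σ (w * u - k) * f u‖ ≤ ∫ u, σ (w * u - k) * B := by
      refine norm_integral_le_of_norm_le hint (ae_of_all _ fun u => ?_)
      rw [norm_mul, Real.norm_of_nonneg (h.nonneg _)]
      exact mul_le_mul_of_nonneg_left (hB u) (h.nonneg _)
    calc |w * ∫ u, σ (w * u - k) * f u| = w * ‖∫ u, σ (w * u - k) * f u‖ := by
          rw [abs_mul, abs_of_pos hw, Real.norm_eq_abs]
      _ ≤ w * ∫ u, σ (w * u - k) * B := by gcongr
      _ = B := by
          rw [integral_comp_dilate_translate hw (fun v => σ v * B), integral_mul_const,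
            h.integral_eq_one, one_mul]
  have hlin : UniformContinuous fun x : ℝ => w * x := uniformContinuous_const_smul w
  exact (h.uniformContinuous_tsum_mul hcoef).comp hlin

/-- Boundedness of the operator on `L^p(ℝ)`, uniformly in `p` and `w`. -/
lemma normLp_durrmeyer_le (h : IsSplineKernel σ R) (hw : 0 < w) {p : ℝ≥0∞} (hp : 1 ≤ p)
    {f : ℝ → ℝ} (hm : Measurable f) (hf : LocallyIntegrable f) :
    normLp p (durrmeyer σ σ w f) ≤ ENNReal.ofReal (4 * R) * normLp p f := by
  have hR := h.radius_pos
  rw [normLp_eq_lpSize hp, normLp_eq_lpSize hp]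
  have hF : Measurable (Function.uncurry fun x s : ℝ => ‖f (x + s)‖ₑ) := by
    unfold Function.uncurry
    fun_prop
  calc lpSize p (fun x => ‖durrmeyer σ σ w f x‖ₑ)
      ≤ lpSize p (fun x => ENNReal.ofReal w *
          ∫⁻ s in Set.Ioc (-(2 * R / w)) (2 * R / w), ‖f (x + s)‖ₑ) :=
        lpSize_mono (h.enorm_durrmeyer_le hw hf)
    _ = ENNReal.ofReal w * lpSize p
          (fun x => ∫⁻ s in Set.Ioc (-(2 * R / w)) (2 * R / w), ‖f (x + s)‖ₑ) :=
        lpSize_const_mul hp _ hF.lintegral_prod_right'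
    _ ≤ ENNReal.ofReal w * (volume (Set.Ioc (-(2 * R / w)) (2 * R / w)) *
          lpSize p fun x => ‖f x‖ₑ) := by
        gcongr
        exact lpSize_setLIntegral_le hp hF fun s _ =>
          (lpSize_comp_add_right (fun x => ‖f x‖ₑ) s).le
    _ = ENNReal.ofReal (4 * R) * lpSize p fun x => ‖f x‖ₑ := by
        rw [Real.volume_Ioc, ← mul_assoc, ← ENNReal.ofReal_mul hw.le]
        congr 2
        field_simp
        ring

lemma inLp_durrmeyer (h : IsSplineKernel σ R) (hw : 0 < w) {p : ℝ≥0∞} (hp : 1 ≤ p)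
    {f : ℝ → ℝ} (hm : Measurable f) (hf : InLp p f) : InLp p (durrmeyer σ σ w f) := by
  have hloc := hf.locallyIntegrable hp
  have hle := h.normLp_durrmeyer_le hw hp hm hloc
  have hR := h.radius_pos
  unfold InLp at hf ⊢
  unfold normLp at hle
  split_ifs at hf hle ⊢ with htop
  · obtain ⟨-, B, hB⟩ := hf
    refine ⟨h.uniformContinuous_durrmeyer hw hB, 4 * R * B, fun x => ?_⟩
    have hB0 : 0 ≤ B := (abs_nonneg _).trans (hB 0)
    have h1 : ‖durrmeyer σ σ w f x‖ₑ ≤ ENNReal.ofReal (4 * R) * ENNReal.ofReal B :=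
      (le_iSup (fun x => ‖durrmeyer σ σ w f x‖ₑ) x).trans (hle.trans (by
        gcongr
        refine iSup_le fun y => ?_
        rw [Real.enorm_eq_ofReal_abs]
        exact ENNReal.ofReal_le_ofReal (hB y)))
    rw [← ENNReal.ofReal_mul (by positivity), Real.enorm_eq_ofReal_abs] at h1
    exact (ENNReal.ofReal_le_ofReal_iff (by positivity)).1 h1
  · exact ⟨(h.continuous_durrmeyer f).aestronglyMeasurable,
      hle.trans_lt (ENNReal.mul_lt_top ENNReal.ofReal_lt_top hf.2)⟩

end IsSplineKernel

lemma LpEq.durrmeyer_eq {p : ℝ≥0∞} {f g : ℝ → ℝ} (h : LpEq p f g) (φ ψ : ℝ → ℝ) (w : ℝ) :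
    durrmeyer φ ψ w f = durrmeyer φ ψ w g := by
  funext x
  unfold durrmeyer
  refine tsum_congr fun k => ?_
  congr 2
  refine integral_congr_ae ?_
  filter_upwards [h.1] with u hu
  rw [hu]

section

/-! ### Steklov means -/

/-- The primitive of `f` vanishing at the origin. -/
def primitive (f : ℝ → ℝ) (x : ℝ) : ℝ := ∫ t in (0 : ℝ)..x, f t

/-- The Steklov mean `h⁻² ∫₀ʰ ∫₀ʰ f(x + s - t) ds dt`, written as a second difference of the second
primitive of `f`. -/
def steklov (f : ℝ → ℝ) (h x : ℝ) : ℝ :=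
  1 / h ^ 2 * (primitive (primitive f) (x + h) - 2 * primitive (primitive f) x +
    primitive (primitive f) (x - h))

/-- The derivative of the Steklov mean. -/
def steklovDeriv (f : ℝ → ℝ) (h x : ℝ) : ℝ :=
  1 / h ^ 2 * (primitive f (x + h) - 2 * primitive f x + primitive f (x - h))

variable {f : ℝ → ℝ}

lemma continuous_primitive (hf : LocallyIntegrable f) : Continuous (primitive f) :=
  intervalIntegral.continuous_primitive (fun a b => hf.intervalIntegrable a b) 0

lemma primitive_sub_primitive (hf : LocallyIntegrable f) (a b : ℝ) :
    primitive f b - primitive f a = ∫ t in a..b, f t :=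
  intervalIntegral.integral_interval_sub_left (hf.intervalIntegrable _ _)
    (hf.intervalIntegrable _ _)

lemma hasDerivAt_steklov (hf : LocallyIntegrable f) (h x : ℝ) :
    HasDerivAt (steklov f h) (steklovDeriv f h x) x := by
  have hd : ∀ y, HasDerivAt (primitive (primitive f)) (primitive f y) y := fun y =>
    (continuous_primitive hf).integral_hasStrictDerivAt 0 y |>.hasDerivAt
  have h1 := (hd (x + h)).comp_add_const x h
  have h2 := (hd (x - h)).comp_sub_const x h
  exact ((h1.sub ((hd x).const_mul 2)).add h2).const_mul (1 / h ^ 2)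

lemma continuous_steklov (hf : LocallyIntegrable f) (h : ℝ) : Continuous (steklov f h) :=
  continuous_iff_continuousAt.2 fun x => (hasDerivAt_steklov hf h x).continuousAt

lemma intervalIntegrable_comp_add (hf : LocallyIntegrable f) (c a b : ℝ) :
    IntervalIntegrable (fun t => f (t + c)) volume a b := by
  have := (hf.intervalIntegrable (a + c) (b + c)).comp_add_right c
  simpa using this

lemma intervalIntegrable_finDiff_two (hf : LocallyIntegrable f) (h a b : ℝ) :
    IntervalIntegrable (fun t => finDiff 2 h f (t - h)) volume a b := by
  have e : (fun t => finDiff 2 h f (t - h)) = fun t => f (t + h) - 2 * f t + f (t + -h) := by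
    funext t
    rw [finDiff_two]
    congr 3 <;> ring_nf
  rw [e]
  exact ((intervalIntegrable_comp_add hf h a b).sub
    ((hf.intervalIntegrable a b).const_mul 2)).add (intervalIntegrable_comp_add hf (-h) a b)

/-- The second derivative of the Steklov mean is the second difference of `f` divided by `h²`. -/
lemma steklovDeriv_sub (hf : LocallyIntegrable f) (h x y : ℝ) :
    steklovDeriv f h y - steklovDeriv f h x =
      1 / h ^ 2 * ∫ t in x..y, finDiff 2 h f (t - h) := by
  have e : (fun t => finDiff 2 h f (t - h)) = fun t => f (t + h) - 2 * f t + f (t + -h) := by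
    funext t
    rw [finDiff_two]
    congr 3 <;> ring_nf
  rw [e, intervalIntegral.integral_add ((intervalIntegrable_comp_add hf h x y).sub
      ((hf.intervalIntegrable x y).const_mul 2)) (intervalIntegrable_comp_add hf (-h) x y),
    intervalIntegral.integral_sub (intervalIntegrable_comp_add hf h x y)
      ((hf.intervalIntegrable x y).const_mul 2),
    intervalIntegral.integral_const_mul, intervalIntegral.integral_comp_add_right,
    intervalIntegral.integral_comp_add_right, ← primitive_sub_primitive hf,
    ← primitive_sub_primitive hf, ← primitive_sub_primitive hf]
  unfold steklovDeriv
  simp only [← sub_eq_add_neg]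
  ring

/-- First-order Taylor estimate for the Steklov mean. -/
lemma abs_steklov_taylor_le (hf : LocallyIntegrable f) (h : ℝ) {x u ρ : ℝ} (hu : |u - x| ≤ ρ) :
    |steklov f h u - (steklov f h x + steklovDeriv f h x * (u - x))| ≤
      (1 / h ^ 2 * ∫ t in (x - ρ)..(x + ρ), |finDiff 2 h f (t - h)|) * ρ := by
  have hρ : 0 ≤ ρ := (abs_nonneg _).trans hu
  set K := 1 / h ^ 2 * ∫ t in (x - ρ)..(x + ρ), |finDiff 2 h f (t - h)| with hK
  have hK0 : 0 ≤ K := mul_nonneg (by positivity)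
    (intervalIntegral.integral_nonneg (by linarith) fun _ _ => abs_nonneg _)
  have hbound : ∀ y ∈ Set.Icc (x - ρ) (x + ρ), ‖steklovDeriv f h y - steklovDeriv f h x‖ ≤ K := by
    intro y hy
    rw [steklovDeriv_sub hf, norm_mul, Real.norm_of_nonneg (by positivity), hK]
    refine mul_le_mul_of_nonneg_left ?_ (by positivity)
    refine intervalIntegral.norm_integral_le_integral_norm_uIoc.trans ?_
    rw [intervalIntegral.integral_of_le (by linarith)]
    refine setIntegral_mono_set ?_ (ae_of_all _ fun _ => abs_nonneg _) ?_
    · exact ((intervalIntegrable_iff_integrableOn_Ioc_of_le (by linarith)).1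
        (intervalIntegrable_finDiff_two hf h (x - ρ) (x + ρ))).norm
    · refine (Set.Ioc_subset_Ioc ?_ ?_).eventuallyLE
      · exact le_min (by linarith) hy.1
      · exact max_le (by linarith) hy.2
  have hd : ∀ y ∈ Set.Icc (x - ρ) (x + ρ),
      HasDerivWithinAt (fun y => steklov f h y - steklovDeriv f h x * y)
        (steklovDeriv f h y - steklovDeriv f h x) (Set.Icc (x - ρ) (x + ρ)) y := fun y _ => by
    have := (hasDerivAt_steklov hf h y).sub ((hasDerivAt_id y).const_mul (steklovDeriv f h x))
    rw [mul_one] at this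
    exact this.hasDerivWithinAt
  rw [abs_le] at hu
  have := (convex_Icc (x - ρ) (x + ρ)).norm_image_sub_le_of_norm_hasDerivWithin_le hd hbound
    (x := x) (y := u) ⟨by linarith, by linarith⟩ ⟨by linarith, by linarith⟩
  rw [Real.norm_eq_abs, Real.norm_eq_abs] at this
  calc _ = |steklov f h u - steklovDeriv f h x * u - (steklov f h x - steklovDeriv f h x * x)| := by
        congr 1
        ring
    _ ≤ K * |u - x| := this
    _ ≤ K * ρ := by gcongr; exact abs_le.2 hu

/-- The error of the Steklov mean is an average of second differences centred at `x`: the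
integrand of the mean may be symmetrized under `(s, t) ↦ (t, s)`. -/
lemma steklov_sub_eq (hf : LocallyIntegrable f) {h : ℝ} (hh : 0 < h) (x : ℝ) :
    steklov f h x - f x = 1 / (2 * h ^ 2) *
      ∫ t in (0 : ℝ)..h, ∫ s in (0 : ℝ)..h, finDiff 2 (s - t) f (x - (s - t)) := by
  have hP := continuous_primitive hf
  have hinner : ∀ t : ℝ, ∫ s in (0 : ℝ)..h, finDiff 2 (s - t) f (x - (s - t)) =
      (primitive f (x + h - t) - primitive f (x - t)) +
        (primitive f (t + x) - primitive f (t + (x - h))) - 2 * h * f x := by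
    intro t
    have e : (fun s => finDiff 2 (s - t) f (x - (s - t))) =
        fun s => f (s + (x - t)) + f (x + t - s) - 2 * f x := by
      funext s
      rw [finDiff_two]
      ring_nf
    have i1 := intervalIntegrable_comp_add hf (x - t) 0 h
    have i2 : IntervalIntegrable (fun s => f (x + t - s)) volume 0 h := by
      have := (hf.intervalIntegrable (x + t) (x + t - h)).comp_sub_left (x + t)
      simpa using this
    rw [e, intervalIntegral.integral_sub (i1.add i2) intervalIntegrable_const,
      intervalIntegral.integral_add i1 i2, intervalIntegral.integral_comp_add_right,
      intervalIntegral.integral_comp_sub_left, intervalIntegral.integral_const,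
      ← primitive_sub_primitive hf, ← primitive_sub_primitive hf, smul_eq_mul]
    ring_nf
  simp_rw [hinner]
  have c1 : Continuous fun t => primitive f (x + h - t) := by fun_prop
  have c2 : Continuous fun t => primitive f (x - t) := by fun_prop
  have c3 : Continuous fun t => primitive f (t + x) := by fun_prop
  have c4 : Continuous fun t => primitive f (t + (x - h)) := by fun_prop
  have c12 : Continuous fun t => primitive f (x + h - t) - primitive f (x - t) := c1.sub c2
  have c34 : Continuous fun t => primitive f (t + x) - primitive f (t + (x - h)) := c3.sub c4
  have c : Continuous fun t => primitive f (x + h - t) - primitive f (x - t) +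
    (primitive f (t + x) - primitive f (t + (x - h))) := c12.add c34
  have hPl : LocallyIntegrable (primitive f) := hP.locallyIntegrable
  rw [intervalIntegral.integral_sub
      (c.intervalIntegrable _ _) intervalIntegrable_const,
    intervalIntegral.integral_add (c12.intervalIntegrable _ _) (c34.intervalIntegrable _ _),
    intervalIntegral.integral_sub (c1.intervalIntegrable _ _) (c2.intervalIntegrable _ _),
    intervalIntegral.integral_sub (c3.intervalIntegrable _ _) (c4.intervalIntegrable _ _),
    intervalIntegral.integral_comp_sub_left (primitive f),
    intervalIntegral.integral_comp_sub_left (primitive f),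
    intervalIntegral.integral_comp_add_right (primitive f),
    intervalIntegral.integral_comp_add_right (primitive f), intervalIntegral.integral_const,
    ← primitive_sub_primitive hPl, ← primitive_sub_primitive hPl, ← primitive_sub_primitive hPl,
    ← primitive_sub_primitive hPl, smul_eq_mul]
  unfold steklov
  have e1 : x + h - h = x := by ring
  have e2 : h + (x - h) = x := by ring
  simp only [e1, e2, sub_zero, zero_add]
  rw [add_comm h x]
  field_simp
  ring

lemma enorm_intervalIntegral_le (a b : ℝ) (g : ℝ → ℝ) :
    ‖∫ t in a..b, g t‖ₑ ≤ ∫⁻ t in Set.uIoc a b, ‖g t‖ₑ := by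
  rw [← ofReal_norm, intervalIntegral.norm_intervalIntegral_eq, ofReal_norm]
  exact enorm_integral_le_lintegral_enorm _

lemma normLp_steklov_sub_le {p : ℝ≥0∞} (hp : 1 ≤ p) (hm : Measurable f)
    (hf : LocallyIntegrable f) {h : ℝ} (hh : 0 < h) :
    normLp p (fun x => steklov f h x - f x) ≤ modulus 2 p f h := by
  set S := Set.Ioc (0 : ℝ) h
  have hF3 : Measurable fun z : (ℝ × ℝ) × ℝ =>
      ‖finDiff 2 (z.2 - z.1.2) f (z.1.1 - (z.2 - z.1.2))‖ₑ :=
    ((finDiff_measurable hm 2).comp (by fun_prop :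
      Measurable fun z : (ℝ × ℝ) × ℝ => (z.1.1 - (z.2 - z.1.2), z.2 - z.1.2))).enorm
  have hF2 : Measurable fun z : ℝ × ℝ =>
      ∫⁻ s in S, ‖finDiff 2 (s - z.2) f (z.1 - (s - z.2))‖ₑ := hF3.lintegral_prod_right'
  have hF1 : Measurable fun x : ℝ =>
      ∫⁻ t in S, ∫⁻ s in S, ‖finDiff 2 (s - t) f (x - (s - t))‖ₑ := hF2.lintegral_prod_right'
  have hslice : ∀ t : ℝ, Measurable (Function.uncurry fun x s : ℝ =>
      ‖finDiff 2 (s - t) f (x - (s - t))‖ₑ) := fun t =>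
    ((finDiff_measurable hm 2).comp (by fun_prop :
      Measurable fun z : ℝ × ℝ => (z.1 - (z.2 - t), z.2 - t))).enorm
  have hvol : volume S = ENNReal.ofReal h := by rw [Real.volume_Ioc, sub_zero]
  rw [normLp_eq_lpSize hp]
  calc lpSize p (fun x => ‖steklov f h x - f x‖ₑ)
      ≤ lpSize p (fun x => ENNReal.ofReal (1 / (2 * h ^ 2)) *
          ∫⁻ t in S, ∫⁻ s in S, ‖finDiff 2 (s - t) f (x - (s - t))‖ₑ) := by
        refine lpSize_mono fun x => ?_
        rw [steklov_sub_eq hf hh, enorm_mul, Real.enorm_of_nonneg (by positivity)]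
        gcongr
        refine (enorm_intervalIntegral_le _ _ _).trans ?_
        rw [Set.uIoc_of_le hh.le]
        refine lintegral_mono fun t => (enorm_intervalIntegral_le _ _ _).trans ?_
        rw [Set.uIoc_of_le hh.le]
    _ = ENNReal.ofReal (1 / (2 * h ^ 2)) * lpSize p (fun x =>
          ∫⁻ t in S, ∫⁻ s in S, ‖finDiff 2 (s - t) f (x - (s - t))‖ₑ) :=
        lpSize_const_mul hp _ hF1
    _ ≤ ENNReal.ofReal (1 / (2 * h ^ 2)) * (volume S * (volume S * modulus 2 p f h)) := by
        gcongr
        refine lpSize_setLIntegral_le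
          (F := fun x t => ∫⁻ s in S, ‖finDiff 2 (s - t) f (x - (s - t))‖ₑ) hp hF2 fun t ht => ?_
        refine lpSize_setLIntegral_le hp (hslice t) fun s hs => ?_
        have hst : |s - t| ≤ h := by
          rw [abs_le]
          constructor <;> linarith [hs.1, hs.2, ht.1, ht.2]
        have := lpSize_comp_add_right (p := p) (fun x => ‖finDiff 2 (s - t) f x‖ₑ) (-(s - t))
        simp only [← sub_eq_add_neg] at this
        rw [this, ← normLp_eq_lpSize hp]
        exact normLp_finDiff_le_modulus 2 f hst
    _ = ENNReal.ofReal (1 / 2) * modulus 2 p f h := by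
        rw [hvol, ← mul_assoc, ← mul_assoc, ← ENNReal.ofReal_mul (by positivity),
          ← ENNReal.ofReal_mul (by positivity)]
        congr 2
        field_simp
    _ ≤ 1 * modulus 2 p f h := by
        gcongr
        rw [← ENNReal.ofReal_one]
        exact ENNReal.ofReal_le_ofReal (by norm_num)
    _ = modulus 2 p f h := one_mul _

/-! ### The error estimate -/

namespace IsSplineKernel

variable {σ : ℝ → ℝ} {R w : ℝ}

/-- Subtracting the Taylor polynomial at `x`, which the operator reproduces, leaves a remainder of
second order in the window `|u - x| ≤ 2R/w`. -/
lemma enorm_durrmeyer_steklov_sub_le (h : IsSplineKernel σ R) (hw : 0 < w)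
    (hf : LocallyIntegrable f) (x : ℝ) :
    ‖durrmeyer σ σ w (steklov f (1 / w)) x - steklov f (1 / w) x‖ₑ ≤
      ENNReal.ofReal (8 * R ^ 2 * w) * ∫⁻ s in Set.Ioc (-(2 * R / w)) (2 * R / w),
        ‖finDiff 2 (1 / w) f (x + s - 1 / w)‖ₑ := by
  have hR := h.radius_pos
  have hρ : 0 < 2 * R / w := by positivity
  set ρ := 2 * R / w with hρdef
  set G := steklov f (1 / w)
  set b := steklovDeriv f (1 / w) x
  set I := ∫ t in (x - ρ)..(x + ρ), |finDiff 2 (1 / w) f (t - 1 / w)| with hI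
  have hG : Continuous G := continuous_steklov hf _
  have hT : Continuous fun u => G x + b * (u - x) := by fun_prop
  have hdec : durrmeyer σ σ w G x - G x =
      durrmeyer σ σ w (fun u => G u - (G x + b * (u - x))) x := by
    have := h.durrmeyer_add hw (hG.sub hT).locallyIntegrable hT.locallyIntegrable x
    simp only [Pi.sub_apply, sub_add_cancel] at this
    rw [h.durrmeyer_affine hw] at this
    rw [sub_eq_iff_eq_add]
    exact this
  have hmain : |durrmeyer σ σ w G x - G x| ≤ 8 * R ^ 2 * w * I := by
    rw [hdec]
    refine (h.abs_durrmeyer_le hw (hG.sub hT).locallyIntegrable x).trans ?_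
    rw [← hρdef]
    calc w * ∫ u in (x - ρ)..(x + ρ), |G u - (G x + b * (u - x))|
        ≤ w * ∫ u in (x - ρ)..(x + ρ), (1 / (1 / w) ^ 2 * I) * ρ := by
          refine mul_le_mul_of_nonneg_left ?_ hw.le
          refine intervalIntegral.integral_mono_on (by linarith)
            ((hG.sub hT).abs.intervalIntegrable _ _) intervalIntegrable_const fun u hu => ?_
          exact abs_steklov_taylor_le hf (1 / w)
            (abs_le.2 ⟨by linarith [hu.1], by linarith [hu.2]⟩)
      _ = 8 * R ^ 2 * w * I := by
          rw [intervalIntegral.integral_const, smul_eq_mul, hρdef]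
          field_simp
          ring
  have hint : IntervalIntegrable (fun s => finDiff 2 (1 / w) f (x + s - 1 / w)) volume (-ρ) ρ := by
    have := (intervalIntegrable_finDiff_two hf (1 / w) (x + -ρ) (x + ρ)).comp_add_left x
    simpa using this
  have hshift := intervalIntegral.integral_comp_add_left (a := -ρ) (b := ρ)
    (fun t => |finDiff 2 (1 / w) f (t - 1 / w)|) x
  rw [← sub_eq_add_neg, ← hI, intervalIntegral.integral_of_le (by linarith)] at hshift
  rw [← ofReal_integral_norm_eq_lintegral_enorm
      ((intervalIntegrable_iff_integrableOn_Ioc_of_le (by linarith)).1 hint),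
    ← ENNReal.ofReal_mul (by positivity), Real.enorm_eq_ofReal_abs]
  refine ENNReal.ofReal_le_ofReal (hmain.trans_eq ?_)
  rw [← hshift]
  rfl

lemma normLp_durrmeyer_steklov_sub_le (h : IsSplineKernel σ R) (hw : 0 < w) {p : ℝ≥0∞}
    (hp : 1 ≤ p) (hm : Measurable f) (hf : LocallyIntegrable f) :
    normLp p (fun x => durrmeyer σ σ w (steklov f (1 / w)) x - steklov f (1 / w) x) ≤
      ENNReal.ofReal (32 * R ^ 3) * modulus 2 p f (1 / w) := by
  have hR := h.radius_pos
  set S := Set.Ioc (-(2 * R / w)) (2 * R / w)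
  have hF : Measurable (Function.uncurry fun x s : ℝ =>
      ‖finDiff 2 (1 / w) f (x + s - 1 / w)‖ₑ) :=
    ((finDiff_measurable hm 2).comp (by fun_prop :
      Measurable fun z : ℝ × ℝ => (z.1 + z.2 - 1 / w, 1 / w))).enorm
  rw [normLp_eq_lpSize hp]
  calc lpSize p (fun x => ‖durrmeyer σ σ w (steklov f (1 / w)) x - steklov f (1 / w) x‖ₑ)
      ≤ lpSize p (fun x => ENNReal.ofReal (8 * R ^ 2 * w) *
          ∫⁻ s in S, ‖finDiff 2 (1 / w) f (x + s - 1 / w)‖ₑ) :=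
        lpSize_mono (h.enorm_durrmeyer_steklov_sub_le hw hf)
    _ = ENNReal.ofReal (8 * R ^ 2 * w) * lpSize p (fun x =>
          ∫⁻ s in S, ‖finDiff 2 (1 / w) f (x + s - 1 / w)‖ₑ) :=
        lpSize_const_mul hp _ hF.lintegral_prod_right'
    _ ≤ ENNReal.ofReal (8 * R ^ 2 * w) * (volume S * modulus 2 p f (1 / w)) := by
        gcongr
        refine lpSize_setLIntegral_le hp hF fun s _ => ?_
        have := lpSize_comp_add_right (p := p) (fun x => ‖finDiff 2 (1 / w) f x‖ₑ) (s - 1 / w)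
        simp only [← add_sub_assoc] at this
        rw [this, ← normLp_eq_lpSize hp]
        exact normLp_finDiff_le_modulus 2 f (abs_of_pos (by positivity)).le
    _ = ENNReal.ofReal (32 * R ^ 3) * modulus 2 p f (1 / w) := by
        rw [Real.volume_Ioc, ← mul_assoc, ← ENNReal.ofReal_mul (by positivity)]
        congr 2
        field_simp
        ring

/-- With `f_h` the Steklov mean for `h = 1/w` and `D` the operator,
`D f - f = D (f - f_h) + (D f_h - f_h) + (f_h - f)`. -/
lemma normLp_durrmeyer_sub_le (h : IsSplineKernel σ R) (hw : 0 < w) {p : ℝ≥0∞} (hp : 1 ≤ p)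
    (hm : Measurable f) (hf : LocallyIntegrable f) :
    normLp p (fun x => durrmeyer σ σ w f x - f x) ≤
      ENNReal.ofReal (32 * R ^ 3 + 4 * R + 1) * modulus 2 p f (1 / w) := by
  have hR := h.radius_pos
  set Ω := modulus 2 p f (1 / w)
  set G := steklov f (1 / w)
  have hG : Continuous G := continuous_steklov hf _
  have hGm := hG.measurable
  have hGl := hG.locallyIntegrable (μ := volume)
  have hDm : ∀ g, Measurable (durrmeyer σ σ w g) := fun g => (h.continuous_durrmeyer g).measurable
  have h1 : normLp p (fun x => G x - f x) ≤ Ω := normLp_steklov_sub_le hp hm hf (by positivity)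
  have h2 : normLp p (fun x => durrmeyer σ σ w G x - G x) ≤ ENNReal.ofReal (32 * R ^ 3) * Ω :=
    h.normLp_durrmeyer_steklov_sub_le hw hp hm hf
  have h3 : normLp p (durrmeyer σ σ w fun x => f x - G x) ≤ ENNReal.ofReal (4 * R) * Ω := by
    refine (h.normLp_durrmeyer_le hw hp (hm.sub hGm) (hf.sub hGl)).trans ?_
    gcongr
    refine le_trans (le_of_eq ?_) h1
    simp only [normLp_eq_lpSize hp, Pi.sub_apply]
    congr 1
    funext x
    exact enorm_sub_rev _ _
  rw [normLp_eq_lpSize hp] at h1 h2 h3 ⊢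
  have hdec : ∀ x, durrmeyer σ σ w f x - f x = durrmeyer σ σ w (fun x => f x - G x) x +
      ((durrmeyer σ σ w G x - G x) + (G x - f x)) := by
    intro x
    have : durrmeyer σ σ w (fun u => (f u - G u) + G u) x =
        durrmeyer σ σ w (fun u => f u - G u) x + durrmeyer σ σ w G x :=
      h.durrmeyer_add hw (hf.sub hGl) hGl x
    simp only [sub_add_cancel] at this
    rw [this]
    ring
  calc lpSize p (fun x => ‖durrmeyer σ σ w f x - f x‖ₑ)
      ≤ lpSize p (fun x => ‖durrmeyer σ σ w (fun x => f x - G x) x‖ₑ +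
          (‖durrmeyer σ σ w G x - G x‖ₑ + ‖G x - f x‖ₑ)) := by
        refine lpSize_mono fun x => ?_
        rw [hdec]
        exact (enorm_add_le _ _).trans (by gcongr; exact enorm_add_le _ _)
    _ ≤ ENNReal.ofReal (4 * R) * Ω + (ENNReal.ofReal (32 * R ^ 3) * Ω + Ω) := by
        refine (lpSize_add_le hp (hDm _).enorm
          (((hDm _).sub hGm).enorm.add (hGm.sub hm).enorm)).trans (add_le_add h3 ?_)
        exact (lpSize_add_le hp ((hDm _).sub hGm).enorm (hGm.sub hm).enorm).trans
          (add_le_add h2 h1)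
    _ = ENNReal.ofReal (32 * R ^ 3 + 4 * R + 1) * Ω := by
        rw [ENNReal.ofReal_add (by positivity) zero_le_one,
          ENNReal.ofReal_add (by positivity) (by positivity), ENNReal.ofReal_one]
        ring

end IsSplineKernel

end

/-! ### Functions with a Lipschitz derivative -/

lemma continuous_of_absolutelyContinuousOnInterval {g : ℝ → ℝ}
    (hg : ∀ a b : ℝ, AbsolutelyContinuousOnInterval g a b) : Continuous g := by
  rw [continuous_iff_continuousAt]
  intro x
  refine (hg (x - 1) (x + 1)).continuousOn.continuousAt ?_
  rw [Set.uIcc_of_le (by linarith)]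
  exact Icc_mem_nhds (by linarith) (by linarith)

lemma normLp_finDiff_two_le {p : ℝ≥0∞} (hp : 1 ≤ p) {g k : ℝ → ℝ} (hm : Measurable k)
    (hk : LocallyIntegrable k) (hgk : ∀ a b : ℝ, g b - g a = ∫ s in a..b, k s) (t : ℝ) :
    normLp p (finDiff 2 t g) ≤ ENNReal.ofReal |t| * normLp p (finDiff 1 t k) := by
  have hrep : ∀ x, finDiff 2 t g x = ∫ s in (0 : ℝ)..t, finDiff 1 t k (x + s) := by
    intro x
    have e : ∀ s, finDiff 1 t k (x + s) = k (s + (x + t)) - k (s + x) := fun s => by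
      rw [finDiff_one]
      ring_nf
    simp_rw [e]
    rw [intervalIntegral.integral_sub (intervalIntegrable_comp_add hk _ _ _)
        (intervalIntegrable_comp_add hk _ _ _), intervalIntegral.integral_comp_add_right,
      intervalIntegral.integral_comp_add_right, ← hgk, ← hgk, finDiff_two]
    ring_nf
  have hF : Measurable (Function.uncurry fun x s : ℝ => ‖finDiff 1 t k (x + s)‖ₑ) :=
    ((finDiff_measurable hm 1).comp (by fun_prop :
      Measurable fun z : ℝ × ℝ => (z.1 + z.2, t))).enorm
  have hvol : volume (Set.uIoc 0 t) = ENNReal.ofReal |t| := by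
    rw [Set.uIoc, Real.volume_Ioc, max_sub_min_eq_abs, sub_zero]
  rw [normLp_eq_lpSize hp, normLp_eq_lpSize hp, ← hvol]
  refine (lpSize_mono fun x => ?_).trans (lpSize_setLIntegral_le hp hF fun s _ =>
    (lpSize_comp_add_right (fun x => ‖finDiff 1 t k x‖ₑ) s).le)
  rw [hrep]
  exact enorm_intervalIntegral_le _ _ _

lemma IsLocACDeriv.modulus_two_le {p : ℝ≥0∞} (hp : 1 ≤ p) {f f' : ℝ → ℝ} (hf : InLp p f)
    (hf' : InLp p f') (h : IsLocACDeriv f f') (δ : ℝ) :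
    modulus 2 p f δ ≤ ENNReal.ofReal δ * modulus 1 p f' δ := by
  obtain ⟨g, hfg, hac, hd⟩ := h
  obtain ⟨k, hkm, hk⟩ := hf'.exists_measurable_lpEq
  have hg := continuous_of_absolutelyContinuousOnInterval hac
  have hfg' : LpEq p f g := by
    refine ⟨hfg, fun htop => ?_⟩
    simp only [InLp, htop, if_true] at hf
    exact (hf.1.continuous.ae_eq_iff_eq volume hg).1 hfg
  have hgk : ∀ a b : ℝ, g b - g a = ∫ s in a..b, k s := by
    intro a b
    rw [← (hac a b).integral_deriv_eq_sub]
    refine intervalIntegral.integral_congr_ae ?_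
    filter_upwards [hd, hk.1] with x hx hkx _
    rw [hx.deriv, hkx]
  rw [hfg'.modulus_eq, hk.modulus_eq]
  refine iSup₂_le fun t ht => ?_
  calc normLp p (finDiff 2 t g) ≤ ENNReal.ofReal |t| * normLp p (finDiff 1 t k) :=
        normLp_finDiff_two_le hp hkm ((hf'.congr hk).locallyIntegrable hp) hgk t
    _ ≤ ENNReal.ofReal δ * modulus 1 p k δ := by
        gcongr
        exact normLp_finDiff_le_modulus 1 k ht

lemma InLip.exists_modulus_two_le {p : ℝ≥0∞} (hp : 1 ≤ p) {f : ℝ → ℝ} (h : InLip 2 p f) :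
    ∃ M : ℝ≥0, ∀ᶠ δ in 𝓝[>] (0 : ℝ), modulus 2 p f δ ≤ M * ENNReal.ofReal (δ ^ 2) := by
  obtain ⟨r, β, hβ, hβ', hr, hf, F, hF0, hF, hFr, M, hM⟩ := h
  -- The exponent `2` splits as `r + β` with `0 < β ≤ 1` only for `r = β = 1`.
  have h1 : r = 1 := by
    have h2 : (0 : ℝ) < r := by linarith
    have h3 : (r : ℝ) < 2 := by linarith
    have h2' : 0 < r := by exact_mod_cast h2
    have h3' : r < 2 := by exact_mod_cast h3
    omega
  subst h1
  have hβ1 : β = 1 := by push_cast at hr; linarith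
  subst hβ1
  refine ⟨M, ?_⟩
  filter_upwards [hM, self_mem_nhdsWithin] with δ hδ hδ0
  have hδ0 : 0 < δ := hδ0
  have hd := hF 0 one_pos
  rw [hF0] at hd
  calc modulus 2 p f δ ≤ ENNReal.ofReal δ * modulus 1 p (F 1) δ :=
        hd.modulus_two_le hp hf hFr δ
    _ ≤ ENNReal.ofReal δ * (M * ENNReal.ofReal (δ ^ (1 : ℝ))) := by gcongr
    _ = M * ENNReal.ofReal (δ ^ 2) := by
        rw [Real.rpow_one, pow_two, ENNReal.ofReal_mul hδ0.le]
        ring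

end DurrmeyerSampling

end

open DurrmeyerSampling
theorem mainTheorem8 (n : ℕ) (hn : 2 ≤ n) :
    ∃ C : ℝ, 0 < C ∧
      ∀ p : ℝ≥0∞, 1 ≤ p → ∀ f : ℝ → ℝ, InLp p f →
        (∀ w : ℝ, 0 < w →
          DurrmeyerConverges (centralBSpline n) (centralBSpline n) w f ∧
          InLp p (durrmeyer (centralBSpline n) (centralBSpline n) w f) ∧
          normLp p (fun x => durrmeyer (centralBSpline n) (centralBSpline n) w f x - f x) ≤
            ENNReal.ofReal C * modulus 2 p f (1 / w)) ∧
        (InLip 2 p f →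
          ∃ M : ℝ≥0, ∀ᶠ w : ℝ in atTop,
            normLp p (fun x => durrmeyer (centralBSpline n) (centralBSpline n) w f x - f x) ≤
              M * ENNReal.ofReal (w ^ (-2 : ℝ))) := by
  have hσ := isSplineKernel_centralBSpline hn
  have hR := hσ.radius_pos
  set R : ℝ := (n : ℝ) / 2
  refine ⟨32 * R ^ 3 + 4 * R + 1, by positivity, fun p hp f hf => ?_⟩
  obtain ⟨g, hgm, hfg⟩ := hf.exists_measurable_lpEq
  have hg := hf.congr hfg
  have hbound : ∀ w : ℝ, 0 < w →
      normLp p (fun x => durrmeyer (centralBSpline n) (centralBSpline n) w f x - f x) ≤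
        ENNReal.ofReal (32 * R ^ 3 + 4 * R + 1) * modulus 2 p f (1 / w) := by
    intro w hw
    have heq : LpEq p
        (fun x => durrmeyer (centralBSpline n) (centralBSpline n) w f x - f x)
        (fun x => durrmeyer (centralBSpline n) (centralBSpline n) w g x - g x) := by
      rw [hfg.durrmeyer_eq]
      refine ⟨?_, fun htop => by rw [hfg.2 htop]⟩
      filter_upwards [hfg.1] with x hx
      rw [hx]
    rw [heq.normLp_eq, hfg.modulus_eq]
    exact hσ.normLp_durrmeyer_sub_le hw hp hgm (hg.locallyIntegrable hp)
  refine ⟨fun w hw => ⟨hσ.durrmeyerConverges hw (hf.locallyIntegrable hp), ?_, hbound w hw⟩, ?_⟩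
  · rw [hfg.durrmeyer_eq]
    exact hσ.inLp_durrmeyer hw hp hgm hg
  · intro hlip
    obtain ⟨M, hM⟩ := hlip.exists_modulus_two_le hp
    refine ⟨(32 * R ^ 3 + 4 * R + 1).toNNReal * M, ?_⟩
    have hlim : Tendsto (fun w : ℝ => 1 / w) atTop (𝓝[>] 0) := by
      simp_rw [one_div]
      exact tendsto_inv_atTop_nhdsGT_zero
    filter_upwards [hlim.eventually hM, eventually_gt_atTop 0] with w hw hw0
    refine (hbound w hw0).trans ?_
    have e : w ^ (-2 : ℝ) = (1 / w) ^ 2 := by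
      rw [Real.rpow_neg hw0.le, Real.rpow_two, one_div, inv_pow]
    rw [e, ENNReal.coe_mul, mul_assoc]
    exact mul_le_mul_right hw _
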